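/- Let $P$ be a finite poset and let $\Bbbk$ be a field. Let $L(P)$ be the distributive lattice of poset ideals (down-sets) of $P$ ordered by inclusion, let $S=\Bbbk[x_\alpha : \alpha\in L(P)]$, let $I\subset S$ be the ideal generated by the binomials $x_\alpha x_\beta-x_{\alpha\cap\beta}x_{\alpha\cup\beta}$ with $\alpha,\beta\in L(P)$ incomparable, and let $\Bbbk[P]=S/I$ be the Hibi ring of $P$. Let $C=\{c_1<_P\cdots<_P c_\ell\}$ be a (possibly empty) chain in $P$, and give $S$ the $\mathbb{Z}^{\ell+1}$-multigrading $\deg_C(x_\alpha)=\mathbf{e}_{|\alpha\cap C|}$, where $\mathbf{e}_0,\dots,\mathbf{e}_\ell$ are the unit vectors; the ideal $I$ is homogeneous for it, so $\Bbbk[P]$ is multigraded. Let $\mathcal{K}(\Bbbk[P];\mathbf{t})\in\mathbb{Z}[t_0,\dots,t_\ell]$ be the polynomial with $$\sum_{\mathbf{a}\in\mathbb{Z}_{\ge 0}^{\ell+1}}\dim_{\Bbbk}(\Bbbk[P]_{\mathbf{a}})\,\mathbf{t}^{\mathbf{a}}=\frac{\mathcal{K}(\Bbbk[P];\mathbf{t})}{\prod_{\alpha\in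 L(P)}\bigl(1-\mathbf{t}^{\deg_C(x_\alpha)}\bigr)},$$ and let the multidegree polynomial $\mathcal{C}(\Bbbk[P];\mathbf{t})$ be the sum of all terms of total degree $\operatorname{codim}\Bbbk[P]=\dim S-\dim \Bbbk[P]$ in $\mathcal{K}(\Bbbk[P];1-t_0,\dots,1-t_\ell)$. Then $$\mathcal{C}(\Bbbk[P];\mathbf{t})=\sum_{\mathcal{M}}\mathbf{t}^{\deg_C(\mathcal{M}^c)},$$ where $\mathcal{M}$ runs over all maximal chains of $L(P)$, $\mathcal{M}^c=L(P)\setminus\mathcal{M}$, and $\deg_C(\mathcal{M}^c)=\deg_C\bigl(\prod_{\alpha\in\mathcal{M}^c}x_\alpha\bigr)$. -/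

import Mathlib

open Finset

/-! ## Standard multigraded polynomial rings, `K`-polynomials and multidegree polynomials -/

section Multidegree

variable {σ ι : Type*}

/-- A standard multigrading is given by a map `d : σ → ι`: the variable `x` has as degree
the unit vector `e_{d x}`.  (All degrees of polynomials lie in the nonnegative orthant, so
the degrees are recorded as elements of `ι →₀ ℕ`.) -/
noncomputable def varDegree (d : σ → ι) (x : σ) : ι →₀ ℕ := Finsupp.single (d x) 1

/-- The component `S_a` of multidegree `a` of the polynomial ring `S = k[x : x ∈ σ]`. -/
noncomputable abbrev polyComponent (k : Type*) [Field k] (d : σ → ι) (a : ι →₀ ℕ) :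
    Submodule k (MvPolynomial σ k) :=
  MvPolynomial.weightedHomogeneousSubmodule k (varDegree d) a

/-- The component `(S/I)_a` of multidegree `a`: the image of `S_a` in `S/I`. -/
noncomputable def quotComponent {k : Type*} [Field k] (d : σ → ι)
    (I : Ideal (MvPolynomial σ k)) (a : ι →₀ ℕ) : Submodule k (MvPolynomial σ k ⧸ I) :=
  (polyComponent k d a).map (Ideal.Quotient.mkₐ k I).toLinearMap

/-- The multigraded Hilbert series `∑_a dim_k (S/I)_a t^a`.  For finite `σ` all components are
finite dimensional, so `Module.finrank` is the dimension. -/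
noncomputable def hilbertSeries {k : Type*} [Field k] (d : σ → ι)
    (I : Ideal (MvPolynomial σ k)) : MvPowerSeries ι ℤ :=
  fun a => (Module.finrank k (quotComponent d I a) : ℤ)

/-- `K` is the `K`-polynomial of `S/I`: the polynomial with
`HS(S/I; t) = K(t) / ∏_x (1 - t^{deg x})`. -/
def IsKPolynomial [Fintype σ] {k : Type*} [Field k] (d : σ → ι)
    (I : Ideal (MvPolynomial σ k)) (K : MvPolynomial ι ℤ) : Prop :=
  (K : MvPowerSeries ι ℤ) =
    hilbertSeries d I * ∏ x : σ, (1 - MvPowerSeries.monomial (varDegree d x) 1)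

/-- Krull dimension as a natural number; used only for quotients of polynomial rings in
finitely many variables over a field, whose dimension is finite. -/
noncomputable def natKrullDim (R : Type*) [CommRing R] : ℕ :=
  ((ringKrullDim R).unbotD 0).toNat

/-- `codim (S/I) = dim S - dim S/I`. -/
noncomputable def quotCodim {k : Type*} [Field k] (I : Ideal (MvPolynomial σ k)) : ℕ :=
  natKrullDim (MvPolynomial σ k) - natKrullDim (MvPolynomial σ k ⧸ I)

/-- `c` is the multidegree polynomial of `S/I`: the `K`-polynomial `K(t)` of `S/I` exists, and
`c` is the sum of all terms of total degree `codim (S/I)` in `K(1 - t)`. -/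
def IsMultidegreePolynomial [Fintype σ] {k : Type*} [Field k] (d : σ → ι)
    (I : Ideal (MvPolynomial σ k)) (c : MvPolynomial ι ℤ) : Prop :=
  ∃ K : MvPolynomial ι ℤ, IsKPolynomial d I K ∧
    c = MvPolynomial.homogeneousComponent (quotCodim I)
      (MvPolynomial.aeval (fun i => (1 - MvPolynomial.X i : MvPolynomial ι ℤ)) K)

/-- There is at most one multidegree polynomial. -/
theorem IsMultidegreePolynomial.unique [Fintype σ] {k : Type*} [Field k] {d : σ → ι}
    {I : Ideal (MvPolynomial σ k)} {c c' : MvPolynomial ι ℤ}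
    (h : IsMultidegreePolynomial d I c) (h' : IsMultidegreePolynomial d I c') : c = c' := by
  obtain ⟨K, hK, rfl⟩ := h
  obtain ⟨K', hK', rfl⟩ := h'
  have : K = K' := MvPolynomial.coe_injective ι ℤ (hK.trans hK'.symm)
  rw [this]

end Multidegree

/-! ## Hibi ideals -/

/-- The ideal of `k[x_α : α ∈ L]` generated by the binomials
`x_α x_β - x_{α ∧ β} x_{α ∨ β}` with `α, β ∈ L` incomparable. -/
noncomputable def hibiIdeal (k : Type*) [Field k] (L : Type*) [Lattice L] :
    Ideal (MvPolynomial L k) :=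
  Ideal.span {f | ∃ α β : L, ¬ α ≤ β ∧ ¬ β ≤ α ∧
    f = MvPolynomial.X α * MvPolynomial.X β - MvPolynomial.X (α ⊓ β) * MvPolynomial.X (α ⊔ β)}

section Poset

variable {P : Type*} [PartialOrder P]

/-- The lattice `L(P)` of poset ideals of `P` is `LowerSet P`; it is finite for finite `P`. -/
noncomputable instance LowerSet.instFintypeOfFintype [Fintype P] : Fintype (LowerSet P) :=
  @Fintype.ofFinite _ (Finite.of_injective (fun α : LowerSet P => (α : Set P))
    SetLike.coe_injective)

open Classical in
/-- The index `|α ∩ C| ∈ {0, …, ℓ}`, `ℓ = |C|`, so that `deg_C (x_α) = e_{|α ∩ C|}`. -/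
noncomputable def chainIndex (C : Finset P) (α : LowerSet P) : Fin (#C + 1) :=
  ⟨#{c ∈ C | c ∈ α}, Nat.lt_succ_of_le (card_filter_le _ _)⟩

open Classical in
/-- The set of maximal chains of `L(P)`. -/
noncomputable def maximalChains (P : Type*) [PartialOrder P] [Fintype P] :
    Finset (Finset (LowerSet P)) :=
  {M | IsMaxChain (· ≤ ·) (M : Set (LowerSet P))}

open Classical in
/-- `deg_C (M^c)`, the degree of the product of the variables `x_α` with `α ∉ M`. -/
noncomputable def complDegree [Fintype P] (C : Finset P) (M : Finset (LowerSet P)) :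
    Fin (#C + 1) →₀ ℕ :=
  ∑ α ∈ Mᶜ, varDegree (chainIndex C) α

attribute [local instance] MvPolynomial.weightedGradedAlgebra in
/-- The Hibi ideal is homogeneous for the multigrading given by a chain `C`, so that this
multigrading passes to the Hibi ring `k[P]`. -/
theorem hibiIdeal_isHomogeneous (k : Type*) [Field k] (C : Finset P)
    (hC : IsChain (· ≤ ·) (C : Set P)) :
    (hibiIdeal k (LowerSet P)).IsHomogeneous (polyComponent k (chainIndex C)) := by
  classical
  have key : ∀ α β : LowerSet P, (∀ c ∈ C, c ∈ α → c ∈ β) →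
      chainIndex C (α ⊓ β) = chainIndex C α ∧ chainIndex C (α ⊔ β) = chainIndex C β := by
    intro α β h
    constructor
    · apply Fin.ext
      apply congrArg Finset.card
      apply Finset.filter_congr
      intro c hc
      simp only [LowerSet.mem_inf_iff]
      exact ⟨fun h => h.1, fun h' => ⟨h', h c hc h'⟩⟩
    · apply Fin.ext
      apply congrArg Finset.card
      apply Finset.filter_congr
      intro c hc
      simp only [LowerSet.mem_sup_iff]
      exact ⟨fun h' => h'.elim (h c hc) id, Or.inr⟩
  have hsum : ∀ α β : LowerSet P,
      varDegree (chainIndex C) (α ⊓ β) + varDegree (chainIndex C) (α ⊔ β)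
        = varDegree (chainIndex C) α + varDegree (chainIndex C) β := by
    intro α β
    by_cases h : ∀ c ∈ C, c ∈ α → c ∈ β
    · simp only [varDegree, key α β h]
    · have h2 : ∀ c ∈ C, c ∈ β → c ∈ α := by
        push Not at h
        obtain ⟨a, haC, haα, haβ⟩ := h
        intro c hc hcβ
        rcases hC.total hc haC with hca | hac
        · exact α.lower hca haα
        · exact absurd (β.lower hac hcβ) haβ
      rw [inf_comm, sup_comm]
      simp only [varDegree, key β α h2, add_comm]
  have hX : ∀ α β : LowerSet P, MvPolynomial.IsWeightedHomogeneous (varDegree (chainIndex C))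
      (MvPolynomial.X α * MvPolynomial.X β : MvPolynomial (LowerSet P) k)
      (varDegree (chainIndex C) α + varDegree (chainIndex C) β) := fun α β =>
    (MvPolynomial.isWeightedHomogeneous_X k _ α).mul (MvPolynomial.isWeightedHomogeneous_X k _ β)
  refine Ideal.homogeneous_span (MvPolynomial.weightedHomogeneousSubmodule k
    (varDegree (chainIndex C))) _ ?_
  rintro f ⟨α, β, -, -, rfl⟩
  refine ⟨varDegree (chainIndex C) α + varDegree (chainIndex C) β, ?_⟩
  refine Submodule.sub_mem _ (hX α β) ?_
  rw [← hsum α β]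
  exact hX (α ⊓ β) (α ⊔ β)

end Poset

/-! Call a monomial standard if its support is a chain of `L(P)`. Straightening rewrites every
monomial, within its multidegree, as a standard one modulo `I`, and the toric map `x_α ↦ s ∏_{p ∈ α}
t_p` sends distinct standard monomials to distinct monomials. They therefore form a basis of `k[P]`
(`exists_isStandard`, `weight_toricExponent_injOn`), and the Hilbert series is a sum over chains `s`
of all monomials with support `s`. Hence `K = ∑_s ∏_{x ∈ s} t_x ∏_{x ∉ s} (1 - t_x)`, with `t_x =
t^{deg x}`.

After `t ↦ 1 - t` the term of `s` starts with `∏_{x ∉ s} t_x`, of degree `|L(P)| - |s|`. Every chain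
has at most `|P| + 1` elements, with equality exactly for maximal chains (`isMaxChain_iff_card`),
and `dim k[P] = |P| + 1` (`trdeg_hibiRing`). So the part of degree `codim k[P]` collects the leading
terms of the maximal chains. -/

/-! ### Krull dimension from transcendence degree. -/

theorem ringKrullDim_eq_of_isIntegral_of_injective {R S : Type*} [CommRing R] [CommRing S]
    [Algebra R S] [Algebra.IsIntegral R S] (h : Function.Injective (algebraMap R S)) :
    ringKrullDim S = ringKrullDim R := by
  apply le_antisymm
  -- Incomparability: contraction of primes is strictly monotone.
  · refine Order.krullDim_le_of_strictMono
      (PrimeSpectrum.comap (algebraMap R S)) fun p q hpq => ?_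
    have := Ideal.IsIntegral.comap_lt_comap (R := R)
      (show p.asIdeal < q.asIdeal from hpq)
    exact this
  -- Lying over for the bottom prime, then going up, lifts any chain of primes.
  · refine iSup_le fun l => ?_
    obtain ⟨Q, -, hQ, hQl⟩ := Ideal.exists_ideal_over_prime_of_isIntegral (S := S)
      l.head.asIdeal ⊥ (by
        rw [← RingHom.ker_eq_comap_bot, (RingHom.injective_iff_ker_eq_bot _).1 h]
        exact bot_le)
    have : Q.LiesOver l.head.asIdeal := ⟨hQl.symm⟩
    obtain ⟨l', hl', -⟩ := Ideal.exists_ltSeries_of_hasGoingUp l Q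
    rw [← hl']
    exact Order.LTSeries.length_le_krullDim l'

/-- By Noether normalization `A` is integral over a polynomial ring in `s` variables, so both
invariants equal `s`. -/
theorem ringKrullDim_eq_of_trdeg_eq {k A : Type*} [Field k] [CommRing A] [IsDomain A]
    [Algebra k A] [Algebra.FiniteType k A] {n : ℕ} (h : Algebra.trdeg k A = n) :
    ringKrullDim A = n := by
  obtain ⟨s, g, hg, hint⟩ := exists_integral_inj_algHom_of_fg k A
  let := g.toRingHom.toAlgebra
  have : IsScalarTower k (MvPolynomial (Fin s) k) A :=
    IsScalarTower.of_algebraMap_eq fun x => (g.commutes x).symm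
  have : Algebra.IsIntegral (MvPolynomial (Fin s) k) A := ⟨hint⟩
  have hinj : Function.Injective (algebraMap (MvPolynomial (Fin s) k) A) := hg
  have : FaithfulSMul (MvPolynomial (Fin s) k) A :=
    (faithfulSMul_iff_algebraMap_injective _ _).2 hinj
  have h1 := lift_trdeg_add_eq k (MvPolynomial (Fin s) k) A
  rw [trdeg_eq_zero (R := MvPolynomial (Fin s) k), h, MvPolynomial.trdeg_of_isDomain] at h1
  have hs : s = n := by
    simpa using h1
  rw [ringKrullDim_eq_of_isIntegral_of_injective hinj,
    MvPolynomial.ringKrullDim_of_isNoetherianRing, ringKrullDim_eq_zero_of_field, ← hs]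
  simp

theorem natKrullDim_mvPolynomial (k σ : Type*) [Field k] [Fintype σ] :
    natKrullDim (MvPolynomial σ k) = Fintype.card σ := by
  rw [natKrullDim, MvPolynomial.ringKrullDim_of_isNoetherianRing, ringKrullDim_eq_zero_of_field,
    zero_add, Nat.card_eq_fintype_card]
  rfl

theorem natKrullDim_eq_of_trdeg_eq {k A : Type*} [Field k] [CommRing A] [IsDomain A]
    [Algebra k A] [Algebra.FiniteType k A] {n : ℕ} (h : Algebra.trdeg k A = n) :
    natKrullDim A = n := by
  rw [natKrullDim, ringKrullDim_eq_of_trdeg_eq h]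
  rfl

/-! ### Maximal chains of lower sets: all have `|P| + 1` elements. -/

section Chains

variable {P : Type*} [PartialOrder P] [Fintype P]

theorem LowerSet.ncard_lt_ncard {α β : LowerSet P} (h : α < β) :
    (α : Set P).ncard < (β : Set P).ncard :=
  Set.ncard_lt_ncard (LowerSet.coe_ssubset_coe.2 h)

theorem LowerSet.ncard_le (α : LowerSet P) : (α : Set P).ncard ≤ Fintype.card P := by
  rw [← Nat.card_eq_fintype_card, ← Set.ncard_univ]
  exact Set.ncard_le_ncard (Set.subset_univ _)

theorem ncard_injOn_of_isChain {M : Set (LowerSet P)} (hM : IsChain (· ≤ ·) M) :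
    Set.InjOn (fun α : LowerSet P => (α : Set P).ncard) M := by
  intro α hα β hβ h
  by_contra hne
  rcases hM.total hα hβ with h' | h'
  · exact absurd h (LowerSet.ncard_lt_ncard (lt_of_le_of_ne h' hne)).ne
  · exact absurd h (LowerSet.ncard_lt_ncard (lt_of_le_of_ne h' (Ne.symm hne))).ne'

theorem card_le_of_isChain {M : Finset (LowerSet P)}
    (hM : IsChain (· ≤ ·) (M : Set (LowerSet P))) : #M ≤ Fintype.card P + 1 := by
  rw [← Finset.card_range (Fintype.card P + 1)]
  exact Finset.card_le_card_of_injOn (fun α : LowerSet P => (α : Set P).ncard)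
    (fun α _ => by simpa [Nat.lt_succ_iff] using α.ncard_le) (ncard_injOn_of_isChain hM)

/-- Adjoining to `α` a minimal element of `γ \ α` keeps it a lower set. -/
theorem LowerSet.exists_between_of_lt {α γ : LowerSet P} (h : α < γ) :
    ∃ β : LowerSet P, α < β ∧ β ≤ γ ∧ (β : Set P).ncard = (α : Set P).ncard + 1 := by
  have hne : ((γ : Set P) \ α).Nonempty :=
    Set.nonempty_of_ssubset (LowerSet.coe_ssubset_coe.2 h)
  obtain ⟨p, hp⟩ := (Set.toFinite ((γ : Set P) \ α)).exists_minimal hne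
  have hcoe : ((⟨insert p (α : Set P), by
      intro a b hba ha
      rcases ha with rfl | ha
      · by_cases hb : b ∈ (α : Set P)
        · exact Or.inr hb
        · exact Or.inl (le_antisymm hba (hp.2 ⟨γ.lower hba hp.1.1, hb⟩ hba))
      · exact Or.inr (α.lower hba ha)⟩ : LowerSet P) : Set P) = insert p (α : Set P) := rfl
  refine ⟨_, ?_, ?_, (congrArg Set.ncard hcoe).trans (Set.ncard_insert_of_notMem hp.1.2)⟩
  · rw [← LowerSet.coe_ssubset_coe, hcoe]
    exact Set.ssubset_insert hp.1.2
  · rw [← LowerSet.coe_subset_coe, hcoe]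
    exact Set.insert_subset hp.1.1 h.le

theorem exists_mem_ncard_eq_of_isMaxChain {M : Set (LowerSet P)} (hM : IsMaxChain (· ≤ ·) M)
    (n : ℕ) (hn : n ≤ Fintype.card P) : ∃ α ∈ M, (α : Set P).ncard = n := by
  have hmem : ∀ β : LowerSet P, (∀ γ ∈ M, β ≤ γ ∨ γ ≤ β) → β ∈ M := by
    intro β hβ
    have := hM.2 (hM.1.insert fun γ hγ _ => hβ γ hγ) (Set.subset_insert β M)
    rw [this]
    exact Set.mem_insert _ _
  induction n with
  | zero => exact ⟨⊥, hmem _ fun γ _ => Or.inl bot_le, by simp⟩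
  | succ n ih =>
    obtain ⟨α, hα, hαn⟩ := ih (Nat.le_of_succ_le hn)
    have htop : (⊤ : LowerSet P) ∈ M := hmem _ fun γ _ => Or.inr le_top
    have hαtop : α < ⊤ := by
      rw [lt_top_iff_ne_top]
      rintro rfl
      rw [LowerSet.coe_top, Set.ncard_univ, Nat.card_eq_fintype_card] at hαn
      omega
    -- `γ` is the successor of `α` in `M`; any `β` between them is comparable with all of `M`, hence
    -- in `M`.
    obtain ⟨γ, hγ⟩ := (Set.toFinite {γ ∈ M | α < γ}).exists_minimal ⟨⊤, htop, hαtop⟩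
    obtain ⟨β, hαβ, hβγ, hβ⟩ := LowerSet.exists_between_of_lt hγ.1.2
    refine ⟨β, hmem β fun δ hδ => ?_, by omega⟩
    rcases hM.1.total hα hδ with h | h
    · rcases h.eq_or_lt with rfl | h
      · exact Or.inr hαβ.le
      · rcases hM.1.total hγ.1.1 hδ with h' | h'
        · exact Or.inl (hβγ.trans h')
        · exact Or.inl (hβγ.trans (hγ.2 ⟨hδ, h⟩ h'))
    · exact Or.inr (h.trans hαβ.le)

theorem card_of_isMaxChain {M : Finset (LowerSet P)}
    (hM : IsMaxChain (· ≤ ·) (M : Set (LowerSet P))) : #M = Fintype.card P + 1 := by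
  refine le_antisymm (card_le_of_isChain hM.1) ?_
  rw [← Finset.card_range (Fintype.card P + 1)]
  refine Finset.card_le_card_of_surjOn (fun α : LowerSet P => (α : Set P).ncard) fun n hn => ?_
  obtain ⟨α, hα, h⟩ := exists_mem_ncard_eq_of_isMaxChain hM n (by simpa [Nat.lt_succ_iff] using hn)
  exact ⟨α, hα, h⟩

theorem isMaxChain_iff_card {M : Finset (LowerSet P)} :
    IsMaxChain (· ≤ ·) (M : Set (LowerSet P)) ↔
      IsChain (· ≤ ·) (M : Set (LowerSet P)) ∧ #M = Fintype.card P + 1 := by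
  refine ⟨fun h => ⟨h.1, card_of_isMaxChain h⟩, fun h => ⟨h.1, fun T hT hMT => ?_⟩⟩
  lift T to Finset (LowerSet P) using Set.toFinite T
  rw [Finset.coe_subset] at hMT
  rw [Finset.eq_of_subset_of_card_le hMT (h.2 ▸ card_le_of_isChain hT)]

variable (P) in
theorem exists_isChain_card :
    ∃ M : Finset (LowerSet P), IsChain (· ≤ ·) (M : Set (LowerSet P)) ∧
      #M = Fintype.card P + 1 := by
  obtain ⟨T, hT⟩ : ∃ T : Set (LowerSet P), IsMaxChain (· ≤ ·) T := ⟨_, maxChain_spec⟩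
  lift T to Finset (LowerSet P) using Set.toFinite T
  exact ⟨T, isMaxChain_iff_card.1 hT⟩

end Chains

/-! ### Standard monomials and their toric exponents. -/

section Standard

variable {P : Type*} [PartialOrder P] [Fintype P]

/-- A monomial in the variables `x_α` is standard if its support is a chain. -/
def IsStandard {L : Type*} [LE L] (m : L →₀ ℕ) : Prop :=
  IsChain (· ≤ ·) (m.support : Set L)

open Classical in
/-- The exponent vector of the monomial `s * ∏ p ∈ α, t_p`, where `s` is the variable `none`. -/
noncomputable def toricExponent (α : LowerSet P) : Option P →₀ ℕ :=
  Finsupp.equivFunOnFinite.symm fun o => o.elim 1 fun p => if p ∈ α then 1 else 0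

@[simp]
theorem toricExponent_none (α : LowerSet P) : toricExponent α none = 1 := rfl

open Classical in
theorem toricExponent_some (α : LowerSet P) (p : P) :
    toricExponent α (some p) = if p ∈ α then 1 else 0 := rfl

theorem toricExponent_inf_add_sup (α β : LowerSet P) :
    toricExponent (α ⊓ β) + toricExponent (α ⊔ β) = toricExponent α + toricExponent β := by
  classical
  ext o
  cases o with
  | none => simp
  | some p =>
    simp only [Finsupp.add_apply, toricExponent_some, LowerSet.mem_inf_iff, LowerSet.mem_sup_iff]
    by_cases h1 : p ∈ α <;> by_cases h2 : p ∈ β <;> simp [h1, h2]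

theorem weight_toricExponent_none (m : LowerSet P →₀ ℕ) :
    Finsupp.weight toricExponent m none = ∑ α ∈ m.support, m α := by
  simp [Finsupp.weight_apply, Finsupp.sum, Finsupp.finsetSum_apply]

theorem weight_toricExponent_some_ne_zero (m : LowerSet P →₀ ℕ) (p : P) :
    Finsupp.weight toricExponent m (some p) ≠ 0 ↔ ∃ α ∈ m.support, p ∈ α := by
  classical
  simp only [Finsupp.weight_apply, Finsupp.sum, Finsupp.finsetSum_apply, toricExponent_some,
    Finsupp.smul_apply, ne_eq, Finset.sum_eq_zero_iff, Finsupp.mem_support_iff, smul_eq_mul,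
    mul_ite, mul_one, mul_zero, not_forall, ite_eq_right_iff, exists_prop]
  exact exists_congr fun α => ⟨fun h => ⟨h.1, h.2.1⟩, fun h => ⟨h.1, h.2, h.1⟩⟩

/-- The greatest element of a chain is the union of its members, which the toric exponent detects.
-/
theorem IsStandard.exists_top {m : LowerSet P →₀ ℕ} (hm : IsStandard m) (h0 : m ≠ 0) :
    ∃ α ∈ m.support, (∀ p, p ∈ α ↔ Finsupp.weight toricExponent m (some p) ≠ 0) := by
  obtain ⟨α, hα⟩ := m.support.exists_maximal (Finsupp.support_nonempty_iff.2 h0)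
  refine ⟨α, hα.1, fun p => ?_⟩
  rw [weight_toricExponent_some_ne_zero]
  refine ⟨fun h => ⟨α, hα.1, h⟩, ?_⟩
  rintro ⟨β, hβ, hp⟩
  rcases hm.total (Finset.mem_coe.2 hβ) (Finset.mem_coe.2 hα.1) with h | h
  · exact h hp
  · exact hα.2 hβ h hp

theorem IsStandard.of_add {L : Type*} [LE L] {m n : L →₀ ℕ} (h : IsStandard (m + n)) :
    IsStandard m :=
  h.mono fun α hα => by
    simp only [Finset.mem_coe, Finsupp.mem_support_iff, Finsupp.add_apply] at hα ⊢
    omega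

theorem exists_eq_add_single {L : Type*} {m : L →₀ ℕ} {α : L} (h : α ∈ m.support) :
    ∃ n, m = n + Finsupp.single α 1 :=
  ⟨m - Finsupp.single α 1, (tsub_add_cancel_of_le (by
    rw [Finsupp.single_le_iff]
    exact Nat.one_le_iff_ne_zero.2 (Finsupp.mem_support_iff.1 h))).symm⟩

/-- The exponent determines the greatest factor; divide it out and induct on the total degree, which
is the exponent of `s`. -/
theorem weight_toricExponent_injOn :
    Set.InjOn (Finsupp.weight (toricExponent (P := P))) {m | IsStandard m} := by
  suffices H : ∀ (N : ℕ) (m m' : LowerSet P →₀ ℕ), IsStandard m → IsStandard m' →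
      Finsupp.weight toricExponent m = Finsupp.weight toricExponent m' →
      Finsupp.weight toricExponent m none = N → m = m' from
    fun m hm m' hm' h => H _ m m' hm hm' h rfl
  have h0 : ∀ m : LowerSet P →₀ ℕ, Finsupp.weight toricExponent m none = 0 ↔ m = 0 := by
    intro m
    rw [weight_toricExponent_none, Finset.sum_eq_zero_iff]
    refine ⟨fun h => ?_, fun h => by simp [h]⟩
    ext α
    by_cases hα : α ∈ m.support
    · exact h α hα
    · simpa using hα
  intro N
  induction N with
  | zero =>
    intro m m' _ _ h hN
    rw [(h0 m).1 hN, (h0 m').1 (h ▸ hN)]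
  | succ N ih =>
    intro m m' hm hm' h hN
    obtain ⟨α, hα, hα'⟩ := hm.exists_top fun h' => by
      rw [(h0 m).2 h'] at hN
      omega
    obtain ⟨β, hβ, hβ'⟩ := hm'.exists_top fun h' => by
      rw [h, (h0 m').2 h'] at hN
      omega
    obtain rfl : α = β := by
      ext p
      change p ∈ α ↔ p ∈ β
      rw [hα', hβ', h]
    obtain ⟨n, rfl⟩ := exists_eq_add_single hα
    obtain ⟨n', rfl⟩ := exists_eq_add_single hβ
    rw [map_add, map_add, add_left_inj] at h
    rw [ih n n' hm.of_add hm'.of_add h]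
    rw [map_add, Finsupp.add_apply, Finsupp.weight_single] at hN
    simpa using hN

end Standard

/-! ### The standard monomial basis and the dimension of the Hibi ring. -/

section ToricMap

variable (k : Type*) [Field k] {P : Type*} [PartialOrder P] [Fintype P]

/-- The map `x_α ↦ s * ∏ p ∈ α, t_p` whose kernel is the Hibi ideal. -/
noncomputable def toricMap : MvPolynomial (LowerSet P) k →ₐ[k] MvPolynomial (Option P) k :=
  MvPolynomial.aeval fun α => MvPolynomial.monomial (toricExponent α) 1

theorem toricMap_monomial (m : LowerSet P →₀ ℕ) (c : k) :
    toricMap k (MvPolynomial.monomial m c) =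
      MvPolynomial.monomial (Finsupp.weight toricExponent m) c := by
  rw [toricMap, MvPolynomial.aeval_monomial, Finsupp.weight_apply,
    MvPolynomial.monomial_finsupp_sum_index]
  simp [MvPolynomial.monomial_pow, MvPolynomial.algebraMap_eq]

theorem toricMap_X (α : LowerSet P) :
    toricMap k (MvPolynomial.X α) = MvPolynomial.monomial (toricExponent α) 1 := by
  simp [toricMap]

theorem toricMap_eq_zero_of_mem {f : MvPolynomial (LowerSet P) k}
    (hf : f ∈ hibiIdeal k (LowerSet P)) : toricMap k f = 0 := by
  suffices h : hibiIdeal k (LowerSet P) ≤ RingHom.ker (toricMap k) from h hf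
  refine Ideal.span_le.2 ?_
  rintro f ⟨α, β, -, -, rfl⟩
  simp [RingHom.mem_ker, toricMap_X, MvPolynomial.monomial_mul, toricExponent_inf_add_sup]

/-- The embedding of the Hibi ring into a polynomial ring. -/
noncomputable def hibiEmbedding :
    (MvPolynomial (LowerSet P) k ⧸ hibiIdeal k (LowerSet P)) →ₐ[k] MvPolynomial (Option P) k :=
  Ideal.Quotient.liftₐ _ (toricMap k) fun _ => toricMap_eq_zero_of_mem k

theorem hibiEmbedding_mk (f : MvPolynomial (LowerSet P) k) :
    hibiEmbedding k (Ideal.Quotient.mk _ f) = toricMap k f := rfl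

theorem eq_zero_of_toricMap_eq_zero {f : MvPolynomial (LowerSet P) k}
    (hf : ∀ m ∈ f.support, IsStandard m) (h : toricMap k f = 0) : f = 0 := by
  classical
  rw [← MvPolynomial.support_eq_empty, Finset.eq_empty_iff_forall_notMem]
  intro m hm
  apply MvPolynomial.mem_support_iff.1 hm
  have h1 := congrArg (MvPolynomial.coeff (Finsupp.weight toricExponent m)) h
  rw [f.as_sum, map_sum, MvPolynomial.coeff_sum, Finset.sum_eq_single m] at h1
  · simpa [toricMap_monomial] using h1
  · intro n hn hnm
    rw [toricMap_monomial, MvPolynomial.coeff_monomial, if_neg]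
    exact fun h' => hnm (weight_toricExponent_injOn (hf n hn) (hf m hm) h')
  · exact fun h => absurd hm h

/-- The class of a monomial in the Hibi ring. -/
noncomputable def hibiMonomial (m : LowerSet P →₀ ℕ) :
    MvPolynomial (LowerSet P) k ⧸ hibiIdeal k (LowerSet P) :=
  Ideal.Quotient.mk _ (MvPolynomial.monomial m 1)

theorem linearIndependent_hibiEmbedding_hibiMonomial :
    LinearIndependent k fun m : {m : LowerSet P →₀ ℕ // IsStandard m} =>
      hibiEmbedding k (hibiMonomial k m.1) := by
  have h := (MvPolynomial.basisMonomials (Option P) k).linearIndependent.comp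
    (fun m : {m : LowerSet P →₀ ℕ // IsStandard m} => Finsupp.weight toricExponent m.1)
    fun m n hmn => Subtype.ext (weight_toricExponent_injOn m.2 n.2 hmn)
  have heq : (fun m : {m : LowerSet P →₀ ℕ // IsStandard m} =>
      hibiEmbedding k (hibiMonomial k m.1)) = MvPolynomial.basisMonomials (Option P) k ∘
        fun m : {m : LowerSet P →₀ ℕ // IsStandard m} => Finsupp.weight toricExponent m.1 := by
    funext m
    simp [hibiMonomial, hibiEmbedding_mk, toricMap_monomial]
  rw [heq]
  exact h

theorem linearIndependent_hibiMonomial :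
    LinearIndependent k fun m : {m : LowerSet P →₀ ℕ // IsStandard m} => hibiMonomial k m.1 :=
  LinearIndependent.of_comp (hibiEmbedding k).toLinearMap
    (linearIndependent_hibiEmbedding_hibiMonomial k)

omit [Fintype P] in
theorem hibiMonomial_straighten (n : LowerSet P →₀ ℕ) {α β : LowerSet P} (h1 : ¬ α ≤ β)
    (h2 : ¬ β ≤ α) :
    hibiMonomial k (n + Finsupp.single (α ⊓ β) 1 + Finsupp.single (α ⊔ β) 1) =
      hibiMonomial k (n + Finsupp.single α 1 + Finsupp.single β 1) := by
  have key : ∀ γ δ : LowerSet P, MvPolynomial.monomial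
      (n + Finsupp.single γ 1 + Finsupp.single δ 1) (1 : k) =
        MvPolynomial.monomial n 1 * (MvPolynomial.X γ * MvPolynomial.X δ) := by
    intro γ δ
    simp [MvPolynomial.X, MvPolynomial.monomial_mul, add_assoc]
  rw [hibiMonomial, hibiMonomial, eq_comm, Ideal.Quotient.eq, key, key, ← mul_sub]
  exact Ideal.mul_mem_left _ _ (Ideal.subset_span ⟨α, β, h1, h2, rfl⟩)

/-- A weight on lower sets which decreases strictly under straightening. -/
noncomputable def straightenWeight (α : LowerSet P) : ℕ :=
  (α : Set P).ncard * (Fintype.card P - (α : Set P).ncard)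

/-- The weight is strictly concave in the cardinality, and meet and join spread the two
cardinalities apart with the same sum. -/
theorem straightenWeight_lt {α β : LowerSet P} (h1 : ¬ α ≤ β) (h2 : ¬ β ≤ α) :
    straightenWeight (α ⊓ β) + straightenWeight (α ⊔ β) <
      straightenWeight α + straightenWeight β := by
  have hs : ((α ⊔ β : LowerSet P) : Set P).ncard + ((α ⊓ β : LowerSet P) : Set P).ncard =
      (α : Set P).ncard + (β : Set P).ncard := by
    rw [LowerSet.coe_sup, LowerSet.coe_inf, Set.ncard_union_add_ncard_inter]
  have hα := LowerSet.ncard_lt_ncard (inf_lt_left.2 h1)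
  have hβ := LowerSet.ncard_lt_ncard (inf_lt_right.2 h2)
  have ht := (α ⊔ β).ncard_le
  simp only [straightenWeight]
  obtain ⟨x, hx⟩ := Nat.exists_eq_add_of_lt hα
  obtain ⟨y, hy⟩ := Nat.exists_eq_add_of_lt hβ
  obtain ⟨z, hz⟩ := Nat.exists_eq_add_of_le ht
  generalize ((α ⊓ β : LowerSet P) : Set P).ncard = c at *
  have hu : ((α ⊔ β : LowerSet P) : Set P).ncard = c + (x + 1) + (y + 1) := by omega
  rw [hu] at hz ⊢
  rw [hx, hy, hz, show c + (x + 1) + (y + 1) + z - c = x + 1 + (y + 1) + z by omega,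
    show c + (x + 1) + (y + 1) + z - (c + (x + 1) + (y + 1)) = z by omega,
    show c + (x + 1) + (y + 1) + z - (c + x + 1) = y + 1 + z by omega,
    show c + (x + 1) + (y + 1) + z - (c + y + 1) = x + 1 + z by omega]
  -- The two sides differ by `2 (x + 1) (y + 1)`.
  nlinarith [Nat.zero_le (x * y)]

/-- Replacing an incomparable pair by its meet and join lowers the total `straightenWeight`, so the
process stops; `hd` keeps the degree fixed. -/
theorem exists_isStandard {ι : Type*} (d : LowerSet P → ι)
    (hd : ∀ α β, varDegree d (α ⊓ β) + varDegree d (α ⊔ β) = varDegree d α + varDegree d β)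
    (m : LowerSet P →₀ ℕ) :
    ∃ m', IsStandard m' ∧ m'.mapDomain d = m.mapDomain d ∧
      hibiMonomial k m' = hibiMonomial k m := by
  induction hN : Finsupp.weight straightenWeight m using Nat.strong_induction_on generalizing m with
  | h N ih =>
    by_cases hm : IsStandard m
    · exact ⟨m, hm, rfl, rfl⟩
    · simp only [IsStandard, IsChain, Set.Pairwise, not_forall, not_or] at hm
      obtain ⟨α, hα, β, hβ, hne, h1, h2⟩ := hm
      obtain ⟨n, rfl⟩ := exists_eq_add_single (Finset.mem_coe.1 hβ)
      have hα' : α ∈ n.support := by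
        simpa [Finsupp.single_apply, Ne.symm hne] using hα
      obtain ⟨n, rfl⟩ := exists_eq_add_single hα'
      obtain ⟨m', hm', hmd, hmk⟩ := ih _ (by
        rw [← hN]
        simp only [map_add, Finsupp.weight_single, one_smul]
        have := straightenWeight_lt h1 h2
        omega) (n + Finsupp.single (α ⊓ β) 1 + Finsupp.single (α ⊔ β) 1) rfl
      refine ⟨m', hm', hmd.trans ?_, hmk.trans (hibiMonomial_straighten k n h1 h2)⟩
      simp only [Finsupp.mapDomain_add, Finsupp.mapDomain_single, add_assoc]
      exact congrArg _ (hd α β)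

theorem weight_varDegree {σ ι : Type*} (d : σ → ι) (m : σ →₀ ℕ) :
    Finsupp.weight (varDegree d) m = m.mapDomain d := by
  simp [Finsupp.weight_apply, varDegree, Finsupp.mapDomain]

theorem polyComponent_eq_span {σ ι : Type*} (d : σ → ι) (a : ι →₀ ℕ) :
    polyComponent k d a =
      Submodule.span k ((fun m => MvPolynomial.monomial m (1 : k)) '' {m | m.mapDomain d = a}) := by
  apply le_antisymm
  · intro f hf
    rw [f.as_sum]
    refine Submodule.sum_mem _ fun m hm => ?_
    rw [← mul_one (f.coeff m), ← smul_eq_mul, ← MvPolynomial.smul_monomial]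
    refine Submodule.smul_mem _ _ (Submodule.subset_span ⟨m, ?_, rfl⟩)
    have := hf (MvPolynomial.mem_support_iff.1 hm)
    rwa [weight_varDegree] at this
  · rw [Submodule.span_le]
    rintro _ ⟨m, rfl, rfl⟩
    exact MvPolynomial.isWeightedHomogeneous_monomial _ _ _ (weight_varDegree d m)

theorem quotComponent_eq_span {ι : Type*} (d : LowerSet P → ι)
    (hd : ∀ α β, varDegree d (α ⊓ β) + varDegree d (α ⊔ β) = varDegree d α + varDegree d β)
    (a : ι →₀ ℕ) :
    quotComponent d (hibiIdeal k (LowerSet P)) a =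
      Submodule.span k (Set.range fun m : {m : LowerSet P →₀ ℕ // IsStandard m ∧
        m.mapDomain d = a} => hibiMonomial k m.1) := by
  rw [quotComponent, polyComponent_eq_span, Submodule.map_span, ← Set.image_comp]
  apply le_antisymm
  · rw [Submodule.span_le]
    rintro _ ⟨m, rfl, rfl⟩
    obtain ⟨m', h1, h2, h3⟩ := exists_isStandard k d hd m
    exact Submodule.subset_span ⟨⟨m', h1, h2⟩, h3⟩
  · refine Submodule.span_mono ?_
    rintro _ ⟨m, rfl⟩
    exact ⟨m.1, m.2.2, rfl⟩

theorem finrank_quotComponent {ι : Type*} (d : LowerSet P → ι)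
    (hd : ∀ α β, varDegree d (α ⊓ β) + varDegree d (α ⊔ β) = varDegree d α + varDegree d β)
    (a : ι →₀ ℕ) [Fintype {m : LowerSet P →₀ ℕ // IsStandard m ∧ m.mapDomain d = a}] :
    Module.finrank k (quotComponent d (hibiIdeal k (LowerSet P)) a) =
      Fintype.card {m : LowerSet P →₀ ℕ // IsStandard m ∧ m.mapDomain d = a} := by
  rw [quotComponent_eq_span k d hd a]
  exact finrank_span_eq_card ((linearIndependent_hibiMonomial k).comp
    (fun m : {m : LowerSet P →₀ ℕ // IsStandard m ∧ m.mapDomain d = a} => ⟨m.1, m.2.1⟩)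
    fun m n h => Subtype.ext (Subtype.mk.inj h))

theorem span_hibiMonomial_eq_top :
    Submodule.span k (Set.range fun m : {m : LowerSet P →₀ ℕ // IsStandard m} =>
      hibiMonomial k m.1) = ⊤ := by
  rw [eq_top_iff]
  rintro x -
  obtain ⟨f, rfl⟩ := Ideal.Quotient.mk_surjective x
  induction f using MvPolynomial.induction_on' with
  | monomial m c =>
    -- Degrees play no role here, so the constant degree map suffices.
    obtain ⟨m', h1, -, h3⟩ := exists_isStandard k (fun _ : LowerSet P => ()) (fun _ _ => rfl) m
    have : Ideal.Quotient.mk (hibiIdeal k (LowerSet P)) (MvPolynomial.monomial m c) =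
        c • hibiMonomial k m := by
      change _ = Ideal.Quotient.mk _ (c • MvPolynomial.monomial m 1)
      rw [MvPolynomial.smul_monomial, smul_eq_mul, mul_one]
    rw [this, ← h3]
    exact Submodule.smul_mem _ _ (Submodule.subset_span ⟨⟨m', h1⟩, rfl⟩)
  | add f g hf hg =>
    rw [map_add]
    exact Submodule.add_mem _ hf hg

theorem hibiEmbedding_injective : Function.Injective (hibiEmbedding (P := P) k) := by
  rw [injective_iff_map_eq_zero]
  intro x hx
  have hmem : x ∈ Submodule.span k (Set.range fun m : {m : LowerSet P →₀ ℕ // IsStandard m} =>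
      hibiMonomial k m.1) := span_hibiMonomial_eq_top (P := P) k ▸ Submodule.mem_top
  obtain ⟨c, rfl⟩ := Finsupp.mem_span_range_iff_exists_finsupp.1 hmem
  have hc := linearIndependent_iff.1 (linearIndependent_hibiEmbedding_hibiMonomial k (P := P)) c
    (by
      rw [Finsupp.linearCombination_apply, ← hx, Finsupp.sum, Finsupp.sum, map_sum]
      simp only [map_smul])
  simp [hc]

/-- Every monomial in variables from one chain is standard, so no cancellation occurs under the
toric map. -/
theorem algebraicIndependent_of_isChain {M : Finset (LowerSet P)}
    (hM : IsChain (· ≤ ·) (M : Set (LowerSet P))) :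
    AlgebraicIndependent k fun α : M =>
      Ideal.Quotient.mkₐ k (hibiIdeal k (LowerSet P)) (MvPolynomial.X α.1) := by
  classical
  rw [AlgebraicIndependent, injective_iff_map_eq_zero]
  intro p hp
  have hp' : MvPolynomial.aeval (fun α : M =>
      Ideal.Quotient.mkₐ k (hibiIdeal k (LowerSet P)) (MvPolynomial.X α.1)) p =
      Ideal.Quotient.mkₐ k (hibiIdeal k (LowerSet P)) (MvPolynomial.rename Subtype.val p) := by
    rw [← AlgHom.comp_apply]
    congr 1
    exact MvPolynomial.algHom_ext fun α => by simp
  rw [hp'] at hp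
  have h := congrArg (hibiEmbedding k) hp
  rw [map_zero] at h
  refine MvPolynomial.rename_injective _ Subtype.val_injective ?_
  rw [map_zero]
  refine eq_zero_of_toricMap_eq_zero k (fun m hm => ?_) h
  rw [MvPolynomial.support_rename_of_injective Subtype.val_injective, Finset.mem_image] at hm
  obtain ⟨s, -, rfl⟩ := hm
  refine hM.mono fun α hα => ?_
  obtain ⟨β, -, rfl⟩ := Finset.mem_image.1 (Finsupp.mapDomain_support (Finset.mem_coe.1 hα))
  exact β.2

/-- The embedding into a polynomial ring in `|P| + 1` variables bounds it above, a chain of `|P| +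
1` variables below. -/
theorem trdeg_hibiRing :
    Algebra.trdeg k (MvPolynomial (LowerSet P) k ⧸ hibiIdeal k (LowerSet P)) =
      (Fintype.card P + 1 : ℕ) := by
  apply le_antisymm
  · refine (trdeg_le_of_injective _ (hibiEmbedding_injective k (P := P))).trans_eq ?_
    simp
  · obtain ⟨M, hM, hMc⟩ := exists_isChain_card P
    have := (algebraicIndependent_of_isChain k hM).lift_cardinalMk_le_trdeg
    simpa [hMc] using this

theorem quotCodim_hibiIdeal :
    quotCodim (hibiIdeal k (LowerSet P)) = Fintype.card (LowerSet P) - (Fintype.card P + 1) := by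
  have : IsDomain (MvPolynomial (LowerSet P) k ⧸ hibiIdeal k (LowerSet P)) :=
    (hibiEmbedding_injective k).isDomain (hibiEmbedding k).toRingHom
  rw [quotCodim, natKrullDim_mvPolynomial, natKrullDim_eq_of_trdeg_eq (trdeg_hibiRing k)]

end ToricMap

/-! ### Series of monomials with prescribed supports, and their numerators. -/

section SupportSeries

variable {σ : Type*}

open Classical in
/-- The sum of all monomials whose support is equal to `s`. -/
noncomputable def supportSeries (s : Finset σ) : MvPowerSeries σ ℤ :=
  fun m => if m.support = s then 1 else 0

open Classical in
theorem coeff_supportSeries (s : Finset σ) (m : σ →₀ ℕ) :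
    MvPowerSeries.coeff m (supportSeries s) = if m.support = s then 1 else 0 := rfl

open Classical in
theorem coeff_sum_supportSeries (Δ : Finset (Finset σ)) (m : σ →₀ ℕ) :
    MvPowerSeries.coeff m (∑ s ∈ Δ, supportSeries s) = if m.support ∈ Δ then 1 else 0 := by
  simp [coeff_supportSeries]

theorem supportSeries_empty : supportSeries (∅ : Finset σ) = 1 := by
  classical
  ext m
  simp [coeff_supportSeries, MvPowerSeries.coeff_one]

-- The geometric series `X + X² + ⋯ = X / (1 - X)` in the variable `x`, with the denominator
-- cleared.
open Classical in
theorem supportSeries_insert {s : Finset σ} {x : σ} (hx : x ∉ s) :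
    supportSeries (insert x s) * (1 - MvPowerSeries.X x) =
      supportSeries s * MvPowerSeries.X x := by
  ext m
  rw [mul_sub, mul_one, map_sub, MvPowerSeries.X, MvPowerSeries.coeff_mul_monomial,
    MvPowerSeries.coeff_mul_monomial]
  by_cases hm : Finsupp.single x 1 ≤ m
  · obtain ⟨n, rfl⟩ := exists_add_of_le hm
    rw [if_pos hm, if_pos hm, add_tsub_cancel_left, mul_one, mul_one, coeff_supportSeries,
      coeff_supportSeries, coeff_supportSeries]
    have hsupp : (Finsupp.single x 1 + n).support = insert x n.support := by
      ext y
      by_cases hy : x = y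
      · subst hy
        simp
      · simp [Ne.symm hy]
    rw [hsupp]
    by_cases hn : x ∈ n.support
    · rw [Finset.insert_eq_of_mem hn, sub_self, if_neg]
      rintro rfl
      exact hx hn
    · have h1 : n.support ≠ insert x s := fun h => hn (h ▸ Finset.mem_insert_self x s)
      have h2 : insert x n.support = insert x s ↔ n.support = s :=
        ⟨fun h => by rw [← Finset.erase_insert hn, h, Finset.erase_insert hx], fun h => by rw [h]⟩
      simp only [h2, if_neg h1, sub_zero]
  · rw [if_neg hm, if_neg hm, sub_zero, coeff_supportSeries, if_neg]
    intro h
    apply hm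
    rw [Finsupp.single_le_iff]
    have : x ∈ m.support := h ▸ Finset.mem_insert_self x s
    exact Nat.one_le_iff_ne_zero.2 (Finsupp.mem_support_iff.1 this)

theorem supportSeries_mul_prod (s : Finset σ) :
    supportSeries s * ∏ x ∈ s, (1 - MvPowerSeries.X x) = ∏ x ∈ s, MvPowerSeries.X x := by
  classical
  induction s using Finset.induction_on with
  | empty => simp [supportSeries_empty]
  | insert x s hx ih =>
    rw [Finset.prod_insert hx, Finset.prod_insert hx, ← mul_assoc, supportSeries_insert hx,
      mul_right_comm, ih, mul_comm]

open Classical in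
/-- The numerator of the rational function given by the sum of all monomials with support in `Δ`. -/
noncomputable def complexKPolynomial [Fintype σ] (Δ : Finset (Finset σ)) : MvPolynomial σ ℤ :=
  ∑ s ∈ Δ, (∏ x ∈ s, MvPolynomial.X x) * ∏ x ∈ sᶜ, (1 - MvPolynomial.X x)

theorem coe_complexKPolynomial [Fintype σ] (Δ : Finset (Finset σ)) :
    (complexKPolynomial Δ : MvPowerSeries σ ℤ) =
      (∑ s ∈ Δ, supportSeries s) * ∏ x : σ, (1 - MvPowerSeries.X x) := by
  classical
  rw [complexKPolynomial, ← MvPolynomial.coeToMvPowerSeries.ringHom_apply, map_sum,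
    Finset.sum_mul]
  refine Finset.sum_congr rfl fun s _ => ?_
  rw [map_mul, map_prod, map_prod, ← Finset.prod_mul_prod_compl s, ← mul_assoc,
    supportSeries_mul_prod]
  simp only [map_sub, map_one, MvPolynomial.coeToMvPowerSeries.ringHom_apply, MvPolynomial.coe_X]

theorem rename_one_sub_X {ι : Type*} [Finite σ] (d : σ → ι) (x : σ) :
    MvPowerSeries.rename d (1 - MvPowerSeries.X x : MvPowerSeries σ ℤ) =
      1 - MvPowerSeries.monomial (varDegree d x) 1 := by
  rw [map_sub, map_one, MvPowerSeries.rename_X]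
  rfl

/-- The identity holds in the fine grading by `σ`; specializing each variable `x` to `d x` carries
it to the coarse one. -/
theorem isKPolynomial_rename_complexKPolynomial [Fintype σ] {ι k : Type*} [Field k] {d : σ → ι}
    {I : Ideal (MvPolynomial σ k)} {Δ : Finset (Finset σ)}
    (h : hilbertSeries d I = MvPowerSeries.rename d (∑ s ∈ Δ, supportSeries s)) :
    IsKPolynomial d I (MvPolynomial.rename d (complexKPolynomial Δ)) := by
  rw [IsKPolynomial, ← MvPowerSeries.rename_coe, coe_complexKPolynomial, map_mul, map_prod, h]
  simp only [rename_one_sub_X]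

/-- All terms have degree at least `s.degree`, and only the constant term of `q` attains it. -/
theorem homogeneousComponent_monomial_mul {ι R : Type*} [CommSemiring R] {n : ℕ} {s : ι →₀ ℕ}
    (hn : n ≤ s.degree) (q : MvPolynomial ι R) :
    MvPolynomial.homogeneousComponent n (MvPolynomial.monomial s 1 * q) =
      if s.degree = n then MvPolynomial.monomial s (MvPolynomial.constantCoeff q) else 0 := by
  classical
  ext m
  rw [MvPolynomial.coeff_homogeneousComponent, MvPolynomial.coeff_monomial_mul']
  by_cases hs : s ≤ m
  · obtain ⟨t, rfl⟩ := exists_add_of_le hs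
    rw [if_pos hs, add_tsub_cancel_left, map_add, one_mul]
    by_cases ht : t = 0
    · subst ht
      by_cases h : s.degree = n <;> simp [h, MvPolynomial.constantCoeff_eq]
    · have ht' : t.degree ≠ 0 := by rwa [Ne, Finsupp.degree_eq_zero_iff]
      rw [if_neg (by omega)]
      split_ifs
      · rw [MvPolynomial.coeff_monomial, if_neg]
        simpa using ht
      · simp
  · have hne : s ≠ m := fun h => hs h.le
    by_cases h : s.degree = n <;> simp [hs, h, hne]

-- The substitution turns the factors `1 - t` over `sᶜ` into a monomial and those `t` over `s` into
-- a polynomial with constant term `1`; `hn` ensures that no summand starts below the extracted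
-- degree.
open Classical in
theorem homogeneousComponent_aeval_rename_complexKPolynomial [Fintype σ] {ι : Type*} (d : σ → ι)
    (Δ : Finset (Finset σ)) (n : ℕ) (hn : ∀ s ∈ Δ, #s ≤ n) :
    MvPolynomial.homogeneousComponent (Fintype.card σ - n)
      (MvPolynomial.aeval (fun i => (1 - MvPolynomial.X i : MvPolynomial ι ℤ))
        (MvPolynomial.rename d (complexKPolynomial Δ))) =
      ∑ s ∈ Δ with #sᶜ = Fintype.card σ - n,
        MvPolynomial.monomial (∑ x ∈ sᶜ, varDegree d x) (1 : ℤ) := by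
  rw [complexKPolynomial, map_sum, map_sum, map_sum, Finset.sum_filter]
  refine Finset.sum_congr rfl fun s hs => ?_
  have hdeg : (∑ x ∈ sᶜ, varDegree d x).degree = #sᶜ := by
    simp [varDegree]
  have hmon : ∏ x ∈ sᶜ, (MvPolynomial.X (d x) : MvPolynomial ι ℤ) =
      MvPolynomial.monomial (∑ x ∈ sᶜ, varDegree d x) 1 := by
    rw [MvPolynomial.monomial_sum_one]
    rfl
  have hle : Fintype.card σ - n ≤ (∑ x ∈ sᶜ, varDegree d x).degree := by
    rw [hdeg, Finset.card_compl]
    exact Nat.sub_le_sub_left (hn s hs) _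
  have h := homogeneousComponent_monomial_mul hle
    (∏ x ∈ s, (1 - MvPolynomial.X (d x)) : MvPolynomial ι ℤ)
  rw [← hmon, hdeg] at h
  simp only [map_mul, map_prod, MvPolynomial.rename_X, map_sub, map_one, MvPolynomial.aeval_X,
    sub_sub_cancel] at h ⊢
  rw [mul_comm, h]
  simp

end SupportSeries

/-! ### The Hilbert series of the Hibi ring and the conclusion. -/

section Hibi

variable {P : Type*} [PartialOrder P] [Fintype P]

open Classical in
variable (P) in
/-- The order complex of the lattice of lower sets: the set of all its chains. -/
noncomputable def lowerSetChains : Finset (Finset (LowerSet P)) :=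
  {s | IsChain (· ≤ ·) (s : Set (LowerSet P))}

theorem mem_lowerSetChains {s : Finset (LowerSet P)} :
    s ∈ lowerSetChains P ↔ IsChain (· ≤ ·) (s : Set (LowerSet P)) := by
  simp [lowerSetChains]

theorem hilbertSeries_hibiIdeal (k : Type*) [Field k] {ι : Type*} (d : LowerSet P → ι)
    (hd : ∀ α β, varDegree d (α ⊓ β) + varDegree d (α ⊔ β) = varDegree d α + varDegree d β) :
    hilbertSeries d (hibiIdeal k (LowerSet P)) =
      MvPowerSeries.rename d (∑ s ∈ lowerSetChains P, supportSeries s) := by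
  classical
  ext a
  -- Since `L(P)` is finite, `Finsupp.mapDomain d` has finite fibres.
  have hfin : {m : LowerSet P →₀ ℕ | IsStandard m ∧ m.mapDomain d = a}.Finite :=
    (Filter.TendstoCofinite.finite_preimage_singleton (Finsupp.mapDomain d) a).subset
      fun m hm => hm.2
  let _ : Fintype {m : LowerSet P →₀ ℕ // IsStandard m ∧ m.mapDomain d = a} := hfin.fintype
  rw [MvPowerSeries.coeff_rename]
  simp only [coeff_sum_supportSeries, mem_lowerSetChains]
  rw [Finset.sum_boole]
  refine congrArg Nat.cast ((finrank_quotComponent k d hd a).trans ?_)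
  refine Fintype.card_of_subtype _ fun m => ?_
  rw [Finset.mem_filter, Set.Finite.mem_toFinset, and_comm]
  rfl

/-- Lower sets cut the chain `C` in initial segments, which are nested, so meet and join have the
same two indices as `α` and `β`. -/
theorem varDegree_chainIndex_inf_add_sup {C : Finset P} (hC : IsChain (· ≤ ·) (C : Set P))
    (α β : LowerSet P) :
    varDegree (chainIndex C) (α ⊓ β) + varDegree (chainIndex C) (α ⊔ β) =
      varDegree (chainIndex C) α + varDegree (chainIndex C) β := by
  classical
  have key : ∀ α β : LowerSet P, (∀ c ∈ C, c ∈ α → c ∈ β) →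
      chainIndex C (α ⊓ β) = chainIndex C α ∧ chainIndex C (α ⊔ β) = chainIndex C β := by
    refine fun α β h => ⟨Fin.ext (congrArg Finset.card (Finset.filter_congr fun c hc => ?_)),
      Fin.ext (congrArg Finset.card (Finset.filter_congr fun c hc => ?_))⟩
    · exact ⟨fun h' => h'.1, fun h' => ⟨h', h c hc h'⟩⟩
    · exact ⟨fun h' => h'.elim (h c hc) id, Or.inr⟩
  by_cases h : ∀ c ∈ C, c ∈ α → c ∈ β
  · simp only [varDegree, key α β h]
  · push Not at h
    obtain ⟨a, haC, haα, haβ⟩ := h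
    rw [inf_comm, sup_comm]
    have := key β α fun c hc hcβ => (hC.total hc haC).elim (fun hca => α.lower hca haα)
      fun hac => absurd (β.lower hac hcβ) haβ
    simp only [varDegree, this, add_comm]

theorem maximalChains_eq_filter :
    maximalChains P = {s ∈ lowerSetChains P | #s = Fintype.card P + 1} := by
  ext s
  simp [maximalChains, mem_lowerSetChains, isMaxChain_iff_card]

end Hibi

theorem proposition4p3 (k : Type*) [Field k] (P : Type*) [PartialOrder P] [Fintype P]
    (C : Finset P) (hC : IsChain (· ≤ ·) (C : Set P)) :
    IsMultidegreePolynomial (chainIndex C) (hibiIdeal k (LowerSet P))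
      (∑ M ∈ maximalChains P, MvPolynomial.monomial (complDegree C M) (1 : ℤ)) := by
  classical
  refine ⟨_, isKPolynomial_rename_complexKPolynomial
    (hilbertSeries_hibiIdeal k _ (varDegree_chainIndex_inf_add_sup hC)), ?_⟩
  have hcard : ∀ s ∈ lowerSetChains P, #s ≤ Fintype.card P + 1 := fun s hs =>
    card_le_of_isChain (mem_lowerSetChains.1 hs)
  rw [quotCodim_hibiIdeal, homogeneousComponent_aeval_rename_complexKPolynomial _ _ _ hcard,
    maximalChains_eq_filter]
  refine Finset.sum_congr (Finset.filter_congr fun s hs => ?_) fun s _ => ?_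
  -- A chain of this size shows `|P| + 1 ≤ |L(P)|`, so the natural subtraction in the codimension
  -- does not truncate.
  · obtain ⟨M, -, hM⟩ := exists_isChain_card P
    have h1 := hcard s hs
    have h2 := hM ▸ Finset.card_le_univ M
    rw [Finset.card_compl]
    omega
  · rw [complDegree]
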